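/- Let $G$ be a connected compact Lie group and $n\ge 1$. Let $\Gamma$ be the directed cycle graph with vertices $v_i$ and edges $e_i$ ($i\in\mathbb{Z}/n\mathbb{Z}$), where $e_i$ goes from $v_i$ to $v_{i+1}$. The gauge group $\mathbf{K}=G^{V}\simeq G^{\times n}$ acts on $G^{E}\simeq G^{\times n}$ by $$\mathbf{k}\cdot\mathbf{g}=(k_1g_1k_2^{-1},\,k_2g_2k_3^{-1},\ldots,k_ng_nk_1^{-1}).$$ For $i\in\mathbb{Z}/n\mathbb{Z}$ let $\pi_i:G\to\mathrm{GL}(M^{\pi_i})$ be an irreducible finite dimensional continuous complex representation and $\sigma_i:G\to\mathrm{GL}(S_i)$ a finite dimensional complex representation. Put $\mathbf{S}=S_1\otimes\cdots\otimes S_n$ with $\boldsymbol\sigma(\mathbf{k})=\sigma_1(k_1)\otimes\cdots\otimes\sigma_n(k_n)$, and $\boldsymbol\pi(\mathbf{g})=\pi_1(g_1)\otimes\cdots\otimes\pi_n(g_n)$ on $M^{\pi_1}\otimes\cdots\otimes M^{\pi_n}$. Let $\mathcal{R}^{\boldsymbol\pi}(G^{\times n})$ be the space of continuous functions on $G^{\times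 n}$ spanned by the matrix coefficients of $\boldsymbol\pi$, and let $(\mathcal{R}^{\boldsymbol\pi}(G^{\times n})\otimes\mathbf{S})^{\mathbf{K}}$ be the space of $\boldsymbol\pi$-elementary spin graph functions, i.e. of invariants for the action $(\mathbf{k}\cdot f)(\mathbf{g})=\boldsymbol\sigma(\mathbf{k})f(\mathbf{k}^{-1}\cdot\mathbf{g})$, where elements of $\mathcal{R}^{\boldsymbol\pi}(G^{\times n})\otimes\mathbf{S}$ are viewed as $\mathbf{S}$-valued functions on $G^{\times n}$. For $B\in\mathrm{Hom}(M^{\pi_n},M^{\pi_n}\otimes\mathbf{S})$ let $\mathrm{Tr}^{\mathbf{S}}_{M^{\pi_n}}(B)\in\mathbf{S}$ be the partial trace, i.e. the unique vector with $\phi\bigl(\mathrm{Tr}^{\mathbf{S}}_{M^{\pi_n}}(B)\bigr)=\mathrm{Tr}_{M^{\pi_n}}\bigl((\mathrm{id}\otimes\phi)B\bigr)$ for all $\phi\in\mathbf{S}^*$. For $\boldsymbol\Phi=(\Phi_1,\ldots,\Phi_n)$ with $\Phi_i\in\mathrm{Hom}_G(M^{\pi_i},M^{\pi_{i-1}}\otimes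 S_i)$, where $G$ acts diagonally on $M^{\pi_{i-1}}\otimes S_i$, define the elementary $n$-point trace function $$f^{\boldsymbol\pi}_{\boldsymbol\Phi}(\mathbf{g})=\mathrm{Tr}^{\mathbf{S}}_{M^{\pi_n}}\Bigl((\Phi_1\pi_1(g_1)\otimes\mathrm{id}_{S_2\otimes\cdots\otimes S_n})\cdots(\Phi_{n-1}\pi_{n-1}(g_{n-1})\otimes\mathrm{id}_{S_n})\,\Phi_n\pi_n(g_n)\Bigr).$$ Then there is a linear isomorphism $$\bigotimes_{i\in\mathbb{Z}/n\mathbb{Z}}\mathrm{Hom}_G\bigl(M^{\pi_i},M^{\pi_{i-1}}\otimes S_i\bigr)\;\overset{\sim}{\longrightarrow}\;\bigl(\mathcal{R}^{\boldsymbol\pi}(G^{\times n})\otimes\mathbf{S}\bigr)^{\mathbf{K}},\qquad \bigotimes_i\Phi_i\mapsto f^{\boldsymbol\pi}_{\boldsymbol\Phi}.$$ In particular, the $\boldsymbol\pi$-elementary spin graph functions are exactly the linear combinations of the elementary $n$-point trace functions $f^{\boldsymbol\pi}_{\boldsymbol\Phi}$. -/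

import Mathlib

open scoped TensorProduct Manifold ContDiff

noncomputable section

namespace SpinGraph

/-! ### Representations of groups and matrix coefficients -/

/-- A finite dimensional complex representation `ρ` of a topological group is continuous if
`g ↦ ρ g` is continuous for the canonical topology on the finite dimensional complex vector
space `End(M)`. -/
def IsContinuousRep {G : Type*} [Group G] [TopologicalSpace G]
    {M : Type*} [AddCommGroup M] [Module ℂ M] (ρ : Representation ℂ G M) : Prop :=
  @Continuous G (M →ₗ[ℂ] M) _ (moduleTopology ℂ (M →ₗ[ℂ] M)) (fun g => ρ g)

/-- Matrix coefficients of a continuous representation are continuous. -/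
theorem IsContinuousRep.continuous_coeff {G : Type*} [Group G] [TopologicalSpace G]
    {M : Type*} [AddCommGroup M] [Module ℂ M] {ρ : Representation ℂ G M}
    (h : IsContinuousRep ρ) (φ : Module.Dual ℂ M) (m : M) :
    Continuous (fun g => φ (ρ g m)) := by
  let _ : TopologicalSpace (M →ₗ[ℂ] M) := moduleTopology ℂ (M →ₗ[ℂ] M)
  have : IsModuleTopology ℂ (M →ₗ[ℂ] M) := ⟨rfl⟩
  have hc : Continuous (φ ∘ₗ LinearMap.applyₗ m : (M →ₗ[ℂ] M) →ₗ[ℂ] ℂ) :=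
    IsModuleTopology.continuous_of_linearMap _
  exact hc.comp h

/-- The space `R^ρ(X)` of a representation `ρ` of `X`: the span, inside the continuous functions
on `X`, of the matrix coefficients `x ↦ φ (ρ x m)`. -/
def coeffSpace {X : Type*} [Group X] [TopologicalSpace X]
    {M : Type*} [AddCommGroup M] [Module ℂ M] (ρ : Representation ℂ X M) :
    Submodule ℂ C(X, ℂ) :=
  Submodule.span ℂ {f : C(X, ℂ) | ∃ (φ : Module.Dual ℂ M) (m : M), ∀ x, f x = φ (ρ x m)}

/-- The tensor product representation `⨂ᵢ ρᵢ` of the product group `ι → G`: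
`g ↦ ρ₁(g₁) ⊗ ⋯ ⊗ ρₙ(gₙ)`. -/
def tensorRep {ι : Type*} {G : Type*} [Group G] {M : ι → Type*}
    [∀ i, AddCommGroup (M i)] [∀ i, Module ℂ (M i)]
    (ρ : ∀ i, Representation ℂ G (M i)) :
    Representation ℂ (ι → G) (⨂[ℂ] i, M i) where
  toFun g := PiTensorProduct.map fun i => ρ i (g i)
  map_one' := by
    simp only [Pi.one_apply, map_one]
    exact PiTensorProduct.map_one
  map_mul' g h := by
    simp only [Pi.mul_apply, map_mul]
    exact PiTensorProduct.map_mul _ _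

/-! ### Oriented graphs, gauge action, elementary spin graph functions -/

/-- An oriented graph with vertices `V` and edges `E` (loops and multiple edges allowed). -/
structure OrientedGraph (V E : Type*) where
  /-- the source of an edge -/
  s : E → V
  /-- the target of an edge -/
  t : E → V

section Gauge

variable {V E : Type*} (Γ : OrientedGraph V E) {G : Type*} [Group G]

/-- The gauge action of `K = G^V` on graph connections: `k • g = (k_{s(e)} g_e k_{t(e)}⁻¹)_e`. -/
def gaugeAct (k : V → G) (g : E → G) : E → G :=
  fun e => k (Γ.s e) * g e * (k (Γ.t e))⁻¹

theorem gaugeAct_one (g : E → G) : gaugeAct Γ 1 g = g := by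
  funext e; simp [gaugeAct]

theorem gaugeAct_mul (k l : V → G) (g : E → G) :
    gaugeAct Γ (k * l) g = gaugeAct Γ k (gaugeAct Γ l g) := by
  funext e; simp [gaugeAct, mul_assoc]

variable [TopologicalSpace G] [IsTopologicalGroup G]

theorem continuous_gaugeAct (k : V → G) : Continuous (gaugeAct Γ k : (E → G) → E → G) := by
  unfold gaugeAct; fun_prop

/-- The action of the gauge group on functions: `(k • f)(g) = f(k⁻¹ • g)`. -/
def gaugeRep : Representation ℂ (V → G) C(E → G, ℂ) where
  toFun k :=
    { toFun := fun f => f.comp ⟨gaugeAct Γ k⁻¹, continuous_gaugeAct Γ k⁻¹⟩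
      map_add' := fun _ _ => rfl
      map_smul' := fun _ _ => rfl }
  map_one' := by
    ext f g
    simp [gaugeAct_one]
  map_mul' k l := by
    ext f g
    simp [gaugeAct_mul]

@[simp]
theorem gaugeRep_apply (k : V → G) (f : C(E → G, ℂ)) (g : E → G) :
    gaugeRep Γ k f g = f (gaugeAct Γ k⁻¹ g) := rfl

variable {M : Type*} [AddCommGroup M] [Module ℂ M] (π : Representation ℂ (E → G) M)
  {S : Type*} [AddCommGroup S] [Module ℂ S] (σ : Representation ℂ (V → G) S)

/-- `R^π(G^E)` is stable under the gauge group. -/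
def coeffSubrep : Subrepresentation (gaugeRep Γ (G := G)) where
  toSubmodule := coeffSpace π
  apply_mem_toSubmodule k f hf := by
    induction hf using Submodule.span_induction with
    | mem f hf =>
      obtain ⟨φ, m, h⟩ := hf
      refine Submodule.subset_span
        ⟨φ ∘ₗ π (fun e => (k (Γ.s e))⁻¹), π (fun e => k (Γ.t e)) m, fun g => ?_⟩
      have hg : gaugeAct Γ k⁻¹ g
          = (fun e => (k (Γ.s e))⁻¹) * g * (fun e => k (Γ.t e)) := by
        funext e; simp [gaugeAct]
      rw [gaugeRep_apply, h, hg, map_mul, map_mul]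
      rfl
    | zero => rw [map_zero]; exact Submodule.zero_mem _
    | add f g _ _ hf hg => rw [map_add]; exact Submodule.add_mem _ hf hg
    | smul c f _ hf => rw [map_smul]; exact Submodule.smul_mem _ c hf

/-- The representation of the gauge group `K = G^V` on `R^π(G^E) ⊗ S`, i.e.
`(k • f)(g) = σ(k) f(k⁻¹ • g)` for `f` viewed as an `S`-valued function. -/
def spinRep : Representation ℂ (V → G) (↥(coeffSpace π) ⊗[ℂ] S) :=
  (coeffSubrep Γ π).toRepresentation.tprod σ

/-- The space `(R^π(G^E) ⊗ S)^K` of `π`-elementary spin graph functions, for `K = G^V`. -/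
def elementarySpinGraphFunctions : Submodule ℂ (↥(coeffSpace π) ⊗[ℂ] S)  where
  carrier := {f | ∀ k : V → G, spinRep Γ π σ k f = f}
  zero_mem' := fun k => map_zero _
  add_mem' := fun {f h} hf hh k => by rw [map_add, hf k, hh k]
  smul_mem' := fun c f hf k => by rw [map_smul, hf k]

end Gauge

/-- The `S`-valued function on `X` attached to an element of `R^ρ(X) ⊗ S`: the pure tensor `f ⊗ u`
is the function `x ↦ f(x) u`. -/
def toFunction {X : Type*} [Group X] [TopologicalSpace X]
    {M : Type*} [AddCommGroup M] [Module ℂ M] (ρ : Representation ℂ X M)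
    (S : Type*) [AddCommGroup S] [Module ℂ S] :
    (↥(coeffSpace ρ) ⊗[ℂ] S) →ₗ[ℂ] (X → S) :=
  TensorProduct.lift
    (LinearMap.mk₂ ℂ (fun (f : ↥(coeffSpace ρ)) (u : S) (x : X) => (f : C(X, ℂ)) x • u)
      (fun _ _ _ => by funext x; simp [add_smul])
      (fun _ _ _ => by funext x; simp [mul_smul])
      (fun _ _ _ => by funext x; simp)
      (fun _ _ _ => by funext x; exact smul_comm _ _ _))

@[simp]
theorem toFunction_tmul {X : Type*} [Group X] [TopologicalSpace X]
    {M : Type*} [AddCommGroup M] [Module ℂ M] (ρ : Representation ℂ X M)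
    {S : Type*} [AddCommGroup S] [Module ℂ S] (f : ↥(coeffSpace ρ)) (u : S) (x : X) :
    toFunction ρ S (f ⊗ₜ u) x = (f : C(X, ℂ)) x • u := rfl

/-! ### The directed cycle graph -/

/-- The directed cycle graph with `n + 1` edges (`n + 1 ≥ 1`): vertices and edges are numbered by
`Fin (n + 1)`, and the edge `i` goes from the vertex `i` to the vertex `i + 1` (cyclically). -/
def cycleGraph (n : ℕ) : OrientedGraph (Fin (n + 1)) (Fin (n + 1)) where
  s i := i
  t i := i + 1

/-- The cyclic predecessor `i - 1` in `Fin (n + 1)`. -/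
def cyclicPred {n : ℕ} (i : Fin (n + 1)) : Fin (n + 1) :=
  Fin.cases (Fin.last n) Fin.castSucc i

theorem cyclicPred_eq {n : ℕ} (i : Fin (n + 1)) : cyclicPred i = i - 1 := by
  rw [eq_sub_iff_add_eq]
  induction i using Fin.cases with
  | zero => simp [cyclicPred]
  | succ i => simp [cyclicPred]

/-- The edge `i - 1` is the edge of the cycle graph that ends in the vertex `i`. -/
theorem cycleGraph_t_cyclicPred {n : ℕ} (i : Fin (n + 1)) :
    (cycleGraph n).t (cyclicPred i) = i := by
  rw [cyclicPred_eq]; simp [cycleGraph]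

/-! ### Partial traces and compositions -/

/-- The partial trace of `B : M → M ⊗ S`: the vector of `S` with
`φ (Tr B) = Tr_M ((id ⊗ φ) B)` for all functionals `φ` on `S`. -/
def partialTrace {M S : Type*} [AddCommGroup M] [Module ℂ M]
    [AddCommGroup S] [Module ℂ S] [FiniteDimensional ℂ S] (B : M →ₗ[ℂ] M ⊗[ℂ] S) : S :=
  (Module.evalEquiv ℂ S).symm
    { toFun := fun φ => LinearMap.trace ℂ M ((TensorProduct.rid ℂ M).toLinearMap ∘ₗ
        LinearMap.lTensor M φ ∘ₗ B)
      map_add' := fun φ ψ => by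
        rw [LinearMap.lTensor_add, LinearMap.add_comp, LinearMap.comp_add, map_add]
      map_smul' := fun c φ => by
        rw [LinearMap.lTensor_smul, LinearMap.smul_comp, LinearMap.comp_smul, map_smul]
        rfl }

theorem apply_partialTrace {M S : Type*} [AddCommGroup M] [Module ℂ M]
    [AddCommGroup S] [Module ℂ S] [FiniteDimensional ℂ S] (B : M →ₗ[ℂ] M ⊗[ℂ] S)
    (φ : Module.Dual ℂ S) :
    φ (partialTrace B) = LinearMap.trace ℂ M ((TensorProduct.rid ℂ M).toLinearMap ∘ₗ
        LinearMap.lTensor M φ ∘ₗ B) := by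
  rw [partialTrace, Module.apply_evalEquiv_symm_apply]
  rfl

/-- The multiplication `S₀ ⊗ (S₁ ⊗ ⋯ ⊗ Sₙ) → S₀ ⊗ S₁ ⊗ ⋯ ⊗ Sₙ`,
`u₀ ⊗ (u₁ ⊗ ⋯ ⊗ uₙ) ↦ u₀ ⊗ u₁ ⊗ ⋯ ⊗ uₙ`. -/
def consTensor {n : ℕ} (S : Fin (n + 1) → Type*)
    [∀ i, AddCommGroup (S i)] [∀ i, Module ℂ (S i)] :
    (S 0 ⊗[ℂ] (⨂[ℂ] i : Fin n, S i.succ)) →ₗ[ℂ] ⨂[ℂ] i, S i :=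
  TensorProduct.lift
    (PiTensorProduct.lift.toLinearMap ∘ₗ (PiTensorProduct.tprod ℂ (s := S)).curryLeft)

@[simp]
theorem consTensor_tmul_tprod {n : ℕ} (S : Fin (n + 1) → Type*)
    [∀ i, AddCommGroup (S i)] [∀ i, Module ℂ (S i)] (u : S 0) (v : ∀ i : Fin n, S i.succ) :
    consTensor S (u ⊗ₜ PiTensorProduct.tprod ℂ v) = PiTensorProduct.tprod ℂ (Fin.cons u v) := by
  simp [consTensor]

/-- For `A : M → M' ⊗ S₀` and `B : L → M ⊗ (S₁ ⊗ ⋯ ⊗ Sₙ)`, the composition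
`(A ⊗ id_{S₁ ⊗ ⋯ ⊗ Sₙ}) B : L → M' ⊗ (S₀ ⊗ S₁ ⊗ ⋯ ⊗ Sₙ)`. -/
def composeStep {n : ℕ} (S : Fin (n + 1) → Type*)
    [∀ i, AddCommGroup (S i)] [∀ i, Module ℂ (S i)]
    {L M M' : Type*} [AddCommGroup L] [Module ℂ L] [AddCommGroup M] [Module ℂ M]
    [AddCommGroup M'] [Module ℂ M']
    (A : M →ₗ[ℂ] M' ⊗[ℂ] S 0) (B : L →ₗ[ℂ] M ⊗[ℂ] (⨂[ℂ] i : Fin n, S i.succ)) :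
    L →ₗ[ℂ] M' ⊗[ℂ] (⨂[ℂ] i, S i) :=
  LinearMap.lTensor M' (consTensor S) ∘ₗ
    (TensorProduct.assoc ℂ M' (S 0) (⨂[ℂ] i : Fin n, S i.succ)).toLinearMap ∘ₗ
      LinearMap.rTensor (⨂[ℂ] i : Fin n, S i.succ) A ∘ₗ B

/-- For maps `Aᵢ : Mᵢ₊₁ → Mᵢ ⊗ Sᵢ` (`0 ≤ i < n`), the composition
`(A₀ ⊗ id_{S₁ ⊗ ⋯ ⊗ Sₙ₋₁}) (A₁ ⊗ id_{S₂ ⊗ ⋯ ⊗ Sₙ₋₁}) ⋯ Aₙ₋₁ : Mₙ → M₀ ⊗ (S₀ ⊗ ⋯ ⊗ Sₙ₋₁)`;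
for `n = 0` this is the canonical map `M₀ → M₀ ⊗ ℂ`, where `ℂ` is the empty tensor product. -/
def composeChain : (n : ℕ) → (M : Fin (n + 1) → Type*) → [∀ i, AddCommGroup (M i)] →
    [∀ i, Module ℂ (M i)] → (S : Fin n → Type*) → [∀ i, AddCommGroup (S i)] →
    [∀ i, Module ℂ (S i)] → (∀ i : Fin n, M i.succ →ₗ[ℂ] M i.castSucc ⊗[ℂ] S i) →
    (M (Fin.last n) →ₗ[ℂ] M 0 ⊗[ℂ] (⨂[ℂ] i, S i))
  | 0, M, _, _, S, _, _, _ =>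
      (TensorProduct.mk ℂ (M 0) (⨂[ℂ] i, S i)).flip (PiTensorProduct.tprod ℂ fun i => i.elim0)
  | n + 1, M, _, _, S, _, _, A =>
      composeStep S (A 0)
        (composeChain n (fun i => M i.succ) (fun i => S i.succ) (fun i => A i.succ))

section Trace

variable {G : Type*} [Group G] {n : ℕ} {M S : Fin (n + 1) → Type*}
  [∀ i, AddCommGroup (M i)] [∀ i, Module ℂ (M i)]
  [∀ i, AddCommGroup (S i)] [∀ i, Module ℂ (S i)]
  (π : ∀ i, Representation ℂ G (M i)) (σ : ∀ i, Representation ℂ G (S i))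

/-- The space `Hom_G(M_i, M_{i-1} ⊗ S_i)` of local intertwiners at the vertex `i` of the cycle
graph, with `G` acting diagonally on `M_{i-1} ⊗ S_i`. -/
abbrev LocalIntertwiner (i : Fin (n + 1)) : Type _ :=
  Representation.IntertwiningMap (π i) ((π (cyclicPred i)).tprod (σ i))

variable {π σ}

/-- The composition `(Φ₀ π₀(g₀) ⊗ id) (Φ₁ π₁(g₁) ⊗ id) ⋯ Φₙ πₙ(gₙ) : Mₙ → Mₙ ⊗ (S₀ ⊗ ⋯ ⊗ Sₙ)`. -/
def cyclicComposition (Φ : ∀ i, LocalIntertwiner π σ i) (g : Fin (n + 1) → G) :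
    M (Fin.last n) →ₗ[ℂ] M (Fin.last n) ⊗[ℂ] (⨂[ℂ] i, S i) :=
  composeStep S (M := M 0) (M' := M (Fin.last n)) ((Φ 0).toLinearMap ∘ₗ π 0 (g 0))
    (composeChain n M (fun i => S i.succ)
      (fun i => (Φ i.succ).toLinearMap ∘ₗ π i.succ (g i.succ)))

/-- The elementary (multipoint) trace function `f_Φ`, an `S₀ ⊗ ⋯ ⊗ Sₙ`-valued function on
`G^{n+1}`. -/
def traceFunction [∀ i, FiniteDimensional ℂ (S i)] (Φ : ∀ i, LocalIntertwiner π σ i) :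
    (Fin (n + 1) → G) → ⨂[ℂ] i, S i :=
  fun g => partialTrace (cyclicComposition Φ g)

end Trace

end SpinGraph

end

/-!
Write `Vᵢ = Hom(Mᵢ, Mᵢ₋₁ ⊗ Sᵢ)`. The trace function `f_A` makes sense for arbitrary linear maps
`Aᵢ ∈ Vᵢ`, and it is multilinear in them. If `Aᵢ` is the map of rank one `v ↦ φᵢ(v) yᵢ₋₁ ⊗ uᵢ`, then
the trace collapses to

`f_A(g) = (∏ᵢ φᵢ(πᵢ(gᵢ) yᵢ)) u₁ ⊗ ⋯ ⊗ uₙ`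

(`cyclicTrace_smulRight`, `traceMap_rankOneTensor`). The isomorphism rests on three facts.

* Choose bases of the `Mᵢ` and `Sᵢ`. The tensors of maps of rank one built from basis elements form
  a basis of `⨂ᵢ Vᵢ`, and by the formula they correspond to the products of a matrix coefficient of
  the representation `⨂ᵢ πᵢ` and a basis element of `⨂ᵢ Sᵢ`. These form a basis of `R^π ⊗ S`,
  because the matrix coefficients are linearly independent (`linearIndependent_productCoeff`), a consequence
  of Burnside's theorem for each `πᵢ` (`span_range_eq_top_of_isIrreducible`). Hence `A ↦ f_A` is an
  isomorphism `⨂ᵢ Vᵢ ≃ R^π ⊗ S` (`exists_traceEquiv`).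
* Let the gauge transformations at the vertex `i` act on `Vᵢ` in the natural way. The isomorphism is
  then equivariant (`traceMap_tensorRep`); again this is read off from the formula, as the gauge
  group permutes the tensors of maps of rank one.
* The invariants of a product group on a tensor product of representations of the factors form the
  tensor product of the invariants (`exists_tensor_invariants_equiv`). This needs no complete
  reducibility: a functional on `Vᵢ` that kills the invariants is a combination of functionals
  `ψ ∘ (k - 1)`, and so an invariant tensor is fixed by any projections to the invariants of the
  factors.

The invariants of `Vᵢ` are the intertwiners `Hom_G(Mᵢ, Mᵢ₋₁ ⊗ Sᵢ)`, and the theorem follows by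
restriction to invariants.
-/

noncomputable section

namespace SpinGraph

/-! ### Burnside's theorem -/

/-- Burnside's theorem: the operators of an irreducible finite dimensional complex representation
span the whole endomorphism algebra. By Schur's lemma every linear map commutes with the
endomorphisms of the representation, so that the Jacobson density theorem applies to it. -/
theorem span_range_eq_top_of_isIrreducible {G : Type*} [Group G] {M : Type*} [AddCommGroup M]
    [Module ℂ M] [FiniteDimensional ℂ M] (ρ : Representation ℂ G M) (h : ρ.IsIrreducible) :
    Submodule.span ℂ (Set.range ρ) = ⊤ := by
  classical
  rw [eq_top_iff]
  rintro f -
  let A := MonoidAlgebra ℂ G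
  have hs : Function.Bijective (algebraMap ℂ (Module.End A ρ.asModule)) :=
    IsSimpleModule.algebraMap_end_bijective_of_isAlgClosed ℂ
  let F : Module.End (Module.End A ρ.asModule) ρ.asModule :=
    { toFun := fun v => ρ.asModuleEquiv.symm (f (ρ.asModuleEquiv v))
      map_add' := fun v w => by simp
      map_smul' := fun e v => by
        obtain ⟨c, rfl⟩ := hs.2 e
        simp }
  let b := Module.finBasis ℂ ρ.asModule
  obtain ⟨r, hr⟩ := jacobson_density F (Finset.univ.image b)
  have hf : f = ρ.asAlgebraHom r := by
    refine (b.map ρ.asModuleEquiv).ext fun i => ?_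
    have := congrArg ρ.asModuleEquiv (hr (b i) (Finset.mem_image_of_mem _ (Finset.mem_univ i)))
    rw [Representation.asModuleEquiv_map_smul] at this
    simpa [F] using this
  rw [hf]
  clear hr hf
  induction r using MonoidAlgebra.induction_linear with
  | zero => simp
  | add x y hx hy => rw [map_add]; exact Submodule.add_mem _ hx hy
  | single g c =>
    rw [Representation.asAlgebraHom_single]
    exact Submodule.smul_mem _ _ (Submodule.subset_span ⟨g, rfl⟩)

/-! ### Invariants of tensor products -/

section Invariants

variable {ι : Type*} {V : ι → Type*} [∀ i, AddCommGroup (V i)] [∀ i, Module ℂ (V i)]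

theorem dualDistrib_tprod_map [Finite ι] (ψ : ∀ i, Module.Dual ℂ (V i)) (f : ∀ i, V i →ₗ[ℂ] V i)
    (x : ⨂[ℂ] i, V i) :
    PiTensorProduct.dualDistrib (PiTensorProduct.tprod ℂ ψ) (PiTensorProduct.map f x) =
      PiTensorProduct.dualDistrib (PiTensorProduct.tprod ℂ fun i => ψ i ∘ₗ f i) x := by
  have := Fintype.ofFinite ι
  rw [← LinearMap.comp_apply]
  congr 1
  ext v
  simp

theorem eq_of_dualDistrib_tprod_eq [Finite ι] [∀ i, FiniteDimensional ℂ (V i)]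
    {x y : ⨂[ℂ] i, V i} (h : ∀ ψ : ∀ i, Module.Dual ℂ (V i),
      PiTensorProduct.dualDistrib (PiTensorProduct.tprod ℂ ψ) x =
        PiTensorProduct.dualDistrib (PiTensorProduct.tprod ℂ ψ) y) : x = y := by
  have := Fintype.ofFinite ι
  refine (Basis.piTensorProduct fun i => Module.finBasis ℂ (V i)).ext_elem fun p => ?_
  have key : ∀ z, (Basis.piTensorProduct fun i => Module.finBasis ℂ (V i)).repr z p =
      PiTensorProduct.dualDistrib
        (PiTensorProduct.tprod ℂ fun i => (Module.finBasis ℂ (V i)).coord (p i)) z := by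
    intro z
    rw [← Module.Basis.coord_apply]
    congr 1
    ext v
    simp
  rw [key, key, h]

/-- A functional that vanishes on the invariants is a combination of functionals
`ψ ∘ (ρ k - 1)`. -/
theorem mem_span_of_vanish_on_invariants {G V : Type*} [Group G] [AddCommGroup V] [Module ℂ V]
    [FiniteDimensional ℂ V] (ρ : Representation ℂ G V) (χ : Module.Dual ℂ V)
    (hχ : ∀ v ∈ ρ.invariants, χ v = 0) :
    χ ∈ Submodule.span ℂ {θ : Module.Dual ℂ V | ∃ (k : G) (ψ : Module.Dual ℂ V),
      θ = ψ ∘ₗ ρ k - ψ} := by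
  rw [← Subspace.dualCoannihilator_dualAnnihilator_eq (W := Submodule.span ℂ _),
    Submodule.mem_dualAnnihilator]
  intro v hv
  refine hχ v fun k => ?_
  rw [← sub_eq_zero, ← Module.forall_dual_apply_eq_zero_iff ℂ]
  intro ψ
  rw [Submodule.mem_dualCoannihilator] at hv
  simpa using hv _ (Submodule.subset_span ⟨k, ψ, rfl⟩)

variable {G : Type*} [Group G] [Finite ι] [∀ i, FiniteDimensional ℂ (V i)]
  (ρ : ∀ i, Representation ℂ G (V i))

/-- The action of the `i`-th factor of the group shows that for an invariant `x` every functional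
`ψ₁ ⊗ ⋯ ⊗ ψₙ` depends only on the restriction of `ψᵢ` to the invariants of the `i`-th factor. -/
theorem dualDistrib_update_eq_zero_of_invariant [DecidableEq ι] {x : ⨂[ℂ] i, V i}
    (hx : ∀ k : ι → G, tensorRep ρ k x = x) (ψ : ∀ i, Module.Dual ℂ (V i)) (i : ι)
    (χ : Module.Dual ℂ (V i)) (hχ : ∀ v ∈ (ρ i).invariants, χ v = 0) :
    PiTensorProduct.dualDistrib (PiTensorProduct.tprod ℂ (Function.update ψ i χ)) x = 0 := by
  let D : Module.Dual ℂ (V i) →ₗ[ℂ] ℂ :=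
    (LinearMap.applyₗ x ∘ₗ PiTensorProduct.dualDistrib) ∘ₗ (PiTensorProduct.tprod ℂ).toLinearMap ψ i
  have hD : ∀ θ, D θ =
      PiTensorProduct.dualDistrib (PiTensorProduct.tprod ℂ (Function.update ψ i θ)) x :=
    fun _ => rfl
  rw [← hD, ← LinearMap.mem_ker]
  refine Submodule.span_le.2 ?_ (mem_span_of_vanish_on_invariants (ρ i) χ hχ)
  rintro _ ⟨k, θ, rfl⟩
  rw [SetLike.mem_coe, LinearMap.mem_ker, map_sub, sub_eq_zero, hD, hD]
  conv_rhs => rw [← hx (Pi.mulSingle i k)]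
  change _ = PiTensorProduct.dualDistrib _ (PiTensorProduct.map _ x)
  rw [dualDistrib_tprod_map]
  congr 3
  funext j
  rcases eq_or_ne j i with rfl | hj
  · simp
  · simp only [Function.update_of_ne hj, Pi.mulSingle_eq_of_ne hj, map_one]
    rfl

/-- An invariant tensor is fixed by `⨂ᵢ Pᵢ` whenever each `Pᵢ` is the identity on the invariants of
the `i`-th factor, no matter what `Pᵢ` does elsewhere. -/
theorem map_eq_self_of_invariant {x : ⨂[ℂ] i, V i} (hx : ∀ k : ι → G, tensorRep ρ k x = x)
    (P : ∀ i, V i →ₗ[ℂ] V i) (hP : ∀ i, ∀ v ∈ (ρ i).invariants, P i v = v) :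
    PiTensorProduct.map P x = x := by
  classical
  have := Fintype.ofFinite ι
  refine eq_of_dualDistrib_tprod_eq fun ψ => ?_
  rw [dualDistrib_tprod_map]
  -- the functionals `ψ i` are replaced by `ψ i ∘ P i` one at a time
  have key : ∀ s : Finset ι, PiTensorProduct.dualDistrib
      (PiTensorProduct.tprod ℂ (s.piecewise (fun i => ψ i ∘ₗ P i) ψ)) x =
        PiTensorProduct.dualDistrib (PiTensorProduct.tprod ℂ ψ) x := by
    intro s
    induction s using Finset.induction_on with
    | empty => simp
    | insert i s hi ih =>
      rw [← ih, Finset.piecewise_insert, ← sub_eq_zero]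
      set θ := s.piecewise (fun i => ψ i ∘ₗ P i) ψ with hθ
      have h := dualDistrib_update_eq_zero_of_invariant ρ hx θ i (ψ i ∘ₗ P i - ψ i)
        (fun v hv => by simp [hP i v hv])
      have hi' : θ i = ψ i := by simp [hθ, hi]
      rw [MultilinearMap.map_update_sub, map_sub, LinearMap.sub_apply] at h
      rw [← hi', Function.update_eq_self] at h
      rwa [← hi']
  simpa using key Finset.univ

/-- The invariants of a product group on a tensor product of representations of the factors form
the tensor product of the spaces of invariants. -/
theorem exists_tensor_invariants_equiv {U : ι → Type*} [∀ i, AddCommGroup (U i)]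
    [∀ i, Module ℂ (U i)] (ε : ∀ i, U i ≃ₗ[ℂ] (ρ i).invariants) :
    ∃ e : (⨂[ℂ] i, U i) ≃ₗ[ℂ] (tensorRep ρ).invariants, ∀ u : ∀ i, U i,
      (e (PiTensorProduct.tprod ℂ u)).1 = PiTensorProduct.tprod ℂ fun i => (ε i (u i)).1 := by
  let inc : ∀ i, U i →ₗ[ℂ] V i := fun i => (ρ i).invariants.subtype ∘ₗ (ε i).toLinearMap
  have hinc : ∀ i, LinearMap.ker (inc i) = ⊥ := fun i =>
    LinearMap.ker_eq_bot.2 ((Submodule.injective_subtype _).comp (ε i).injective)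
  -- left inverses of the inclusions give projections to the invariants that need not be equivariant
  choose Q hQ using fun i => LinearMap.exists_leftInverse_of_injective (inc i) (hinc i)
  have hmem : ∀ y, PiTensorProduct.map inc y ∈ (tensorRep ρ).invariants := by
    intro y k
    change PiTensorProduct.map _ (PiTensorProduct.map inc y) = _
    rw [← LinearMap.comp_apply, ← PiTensorProduct.map_comp]
    congr 2
    funext i
    exact LinearMap.ext fun u => (ε i u).2 (k i)
  have hleft : Function.LeftInverse (PiTensorProduct.map Q) (PiTensorProduct.map inc) := by
    intro y
    rw [← LinearMap.comp_apply, ← PiTensorProduct.map_comp]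
    simp [hQ, PiTensorProduct.map_id]
  refine ⟨LinearEquiv.ofBijective ((PiTensorProduct.map inc).codRestrict _ hmem)
    ⟨fun y z h => hleft.injective (congrArg Subtype.val h), fun x => ?_⟩, fun u => ?_⟩
  · refine ⟨PiTensorProduct.map Q x.1, Subtype.ext ?_⟩
    change PiTensorProduct.map inc (PiTensorProduct.map Q x.1) = x.1
    rw [← LinearMap.comp_apply, ← PiTensorProduct.map_comp]
    refine map_eq_self_of_invariant ρ x.2 _ fun i v hv => ?_
    obtain ⟨u, hu⟩ := (ε i).surjective ⟨v, hv⟩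
    have huv : inc i u = v := congrArg Subtype.val hu
    rw [← huv]
    exact congrArg (inc i) (LinearMap.congr_fun (hQ i) u)
  · change PiTensorProduct.map inc (PiTensorProduct.tprod ℂ u) = _
    rw [PiTensorProduct.map_tprod]
    rfl

end Invariants

/-! ### Matrix coefficients of tensor products of irreducible representations -/

/-- A multilinear map that vanishes on spanning sets vanishes. -/
theorem multilinearMap_eq_zero_of_span {ι : Type*} [Finite ι] {V : ι → Type*}
    [∀ i, AddCommGroup (V i)] [∀ i, Module ℂ (V i)] {N : Type*} [AddCommGroup N] [Module ℂ N]
    (T : MultilinearMap ℂ V N) (s : ∀ i, Set (V i)) (hs : ∀ i, Submodule.span ℂ (s i) = ⊤)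
    (h : ∀ v, (∀ i, v i ∈ s i) → T v = 0) : T = 0 :=
  Module.Basis.ext_multilinear (fun i => Module.Basis.ofSpan (hs i).ge) fun j =>
    h _ fun i => Module.Basis.ofSpan_subset (hs i).ge ⟨j i, rfl⟩

section Coeff

variable {ι : Type*} [Fintype ι] {G : Type*} [Group G] [TopologicalSpace G] {M : ι → Type*}
  [∀ i, AddCommGroup (M i)] [∀ i, Module ℂ (M i)] {π : ∀ i, Representation ℂ G (M i)}
  (hcont : ∀ i, IsContinuousRep (π i))

/-- The matrix coefficient `g ↦ ∏ᵢ φᵢ (πᵢ(gᵢ) yᵢ)` of the tensor product representation, for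
`φ = ⨂ᵢ φᵢ` and `y = ⨂ᵢ yᵢ`. -/
def productCoeff (φ : ∀ i, Module.Dual ℂ (M i)) (y : ∀ i, M i) : ↥(coeffSpace (tensorRep π)) :=
  ⟨⟨fun g => ∏ i, φ i (π i (g i) (y i)), continuous_finsetProd _ fun i _ =>
    ((hcont i).continuous_coeff (φ i) (y i)).comp (continuous_apply i)⟩,
    Submodule.subset_span ⟨PiTensorProduct.dualDistrib (PiTensorProduct.tprod ℂ φ),
      PiTensorProduct.tprod ℂ y, fun g => by
        change _ = PiTensorProduct.dualDistrib _ (PiTensorProduct.map _ _)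
        rw [PiTensorProduct.map_tprod, PiTensorProduct.dualDistrib_apply]
        rfl⟩⟩

theorem productCoeff_apply (φ : ∀ i, Module.Dual ℂ (M i)) (y : ∀ i, M i) (g : ι → G) :
    (productCoeff hcont φ y : C(ι → G, ℂ)) g = ∏ i, φ i (π i (g i) (y i)) := rfl

variable {J : ι → Type*} [∀ i, Fintype (J i)] (b : ∀ i, Module.Basis (J i) ℂ (M i))

/-- The matrix coefficients are linearly independent: by Burnside's theorem a linear relation
extends from the operators `πᵢ(gᵢ)` to arbitrary endomorphisms, in particular to matrix units. -/
theorem linearIndependent_productCoeff [∀ i, FiniteDimensional ℂ (M i)]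
    (hirr : ∀ i, (π i).IsIrreducible) :
    LinearIndependent ℂ fun a : (∀ i, J i) × (∀ i, J i) =>
      productCoeff hcont (fun i => (b i).coord (a.1 i)) (fun i => b i (a.2 i)) := by
  classical
  let ev : ↥(coeffSpace (tensorRep π)) →ₗ[ℂ] (ι → G) → ℂ :=
    ContinuousMap.coeFnLinearMap ℂ ∘ₗ (coeffSpace (tensorRep π)).subtype
  refine LinearIndependent.of_comp ev (Fintype.linearIndependent_iff.2 fun c hc a₀ => ?_)
  let T : MultilinearMap ℂ (fun i => M i →ₗ[ℂ] M i) ℂ :=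
    ∑ a : (∀ i, J i) × (∀ i, J i), c a • (MultilinearMap.mkPiAlgebra ℂ ι ℂ).compLinearMap
      fun i => (b i).coord (a.1 i) ∘ₗ LinearMap.applyₗ (b i (a.2 i))
  have hT : ∀ X, T X =
      ∑ a : (∀ i, J i) × (∀ i, J i), c a * ∏ i, (b i).coord (a.1 i) (X i (b i (a.2 i))) := by
    intro X
    simp [T]
  have h0 : T = 0 := by
    refine multilinearMap_eq_zero_of_span T (fun i => Set.range (π i))
      (fun i => span_range_eq_top_of_isIrreducible (π i) (hirr i)) fun X hX => ?_
    choose g hg using hX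
    obtain rfl : (fun i => π i (g i)) = X := funext hg
    rw [hT]
    have := congrFun hc g
    rw [Finset.sum_apply] at this
    exact this
  have h1 := hT fun i => ((b i).coord (a₀.2 i)).smulRight (b i (a₀.1 i))
  rw [h0, Finset.sum_eq_single a₀] at h1
  · simpa using h1.symm
  · intro a _ ha
    by_contra hne
    rw [mul_eq_zero, not_or, ← ne_eq (∏ _, _), Finset.prod_ne_zero_iff] at hne
    refine ha (Prod.ext (funext fun i => ?_) (funext fun i => ?_))
    · by_contra hi
      have h0 : (b i).coord (a.1 i) (b i (a₀.1 i)) = 0 := by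
        rw [Module.Basis.coord_apply, Module.Basis.repr_self, Finsupp.single_eq_of_ne hi]
      exact hne.2 i (Finset.mem_univ i) (by rw [LinearMap.smulRight_apply, map_smul, h0, smul_zero])
    · by_contra hi
      exact hne.2 i (Finset.mem_univ i) (by simp [hi])
  · simp

/-- The matrix coefficients of a tensor product of irreducible representations with respect to
bases of the factors form a basis of the space of all matrix coefficients. -/
def coeffBasis [∀ i, FiniteDimensional ℂ (M i)] (hirr : ∀ i, (π i).IsIrreducible) :
    Module.Basis ((∀ i, J i) × (∀ i, J i)) ℂ ↥(coeffSpace (tensorRep π)) :=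
  Module.Basis.mk (linearIndependent_productCoeff hcont b hirr) <| by
    classical
    rintro ⟨f, hf⟩ -
    induction hf using Submodule.span_induction with
    | zero => exact Submodule.zero_mem _
    | add f g _ _ hf hg => exact Submodule.add_mem _ hf hg
    | smul c f _ hf => exact Submodule.smul_mem _ c hf
    | mem f hf =>
      have hfX := Submodule.subset_span (R := ℂ) hf
      obtain ⟨φ, m, hfm⟩ := hf
      let B := Basis.piTensorProduct b
      have key : (⟨f, hfX⟩ : ↥(coeffSpace (tensorRep π))) =
          ∑ p : ∀ i, J i, ∑ q : ∀ i, J i, (B.repr m q * φ (B p)) •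
            productCoeff hcont (fun i => (b i).coord (p i)) (fun i => b i (q i)) := by
        apply Subtype.ext
        ext g
        have hco : ∀ p q : ∀ i, J i, B.repr (tensorRep π g (B q)) p =
            (productCoeff hcont (fun i => (b i).coord (p i)) (fun i => b i (q i)) :
              C(ι → G, ℂ)) g := by
          intro p q
          change B.repr (PiTensorProduct.map _ (B q)) p = _
          rw [Basis.piTensorProduct_apply, PiTensorProduct.map_tprod,
            Basis.piTensorProduct_repr_tprod_apply]
          rfl
        change f g = _
        rw [hfm]
        conv_lhs => rw [← B.sum_repr m, ← B.sum_repr (tensorRep π g _)]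
        simp only [map_sum, map_smul, Finsupp.coe_finsetSum, Finset.sum_apply, Finsupp.coe_smul,
          Pi.smul_apply, smul_eq_mul, hco, Finset.sum_mul]
        simp only [Submodule.coe_sum, Submodule.coe_smul, ContinuousMap.coe_sum, Finset.sum_apply,
          ContinuousMap.coe_smul, Pi.smul_apply, smul_eq_mul]
        refine Finset.sum_congr rfl fun p _ => Finset.sum_congr rfl fun q _ => ?_
        ring
      rw [key]
      exact Submodule.sum_mem _ fun p _ => Submodule.sum_mem _ fun q _ =>
        Submodule.smul_mem _ _ (Submodule.subset_span ⟨(p, q), rfl⟩)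

theorem coeffBasis_apply [∀ i, FiniteDimensional ℂ (M i)] (hirr : ∀ i, (π i).IsIrreducible)
    (a : (∀ i, J i) × (∀ i, J i)) : coeffBasis hcont b hirr a =
      productCoeff hcont (fun i => (b i).coord (a.1 i)) (fun i => b i (a.2 i)) := by
  simp [coeffBasis]

end Coeff

theorem injective_of_tmul_apply {X R S : Type*} [AddCommMonoid R] [Module ℂ R] [AddCommGroup S]
    [Module ℂ S] (j : R →ₗ[ℂ] X → ℂ) (hj : Function.Injective j) (T : R ⊗[ℂ] S →ₗ[ℂ] X → S)
    (hT : ∀ f u x, T (f ⊗ₜ u) x = j f x • u) : Function.Injective T := by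
  classical
  let c := Module.Basis.ofVectorSpace ℂ S
  -- the coordinates of `t` with respect to `c` are the coordinate functions of `T t`
  have key : ∀ (t : R ⊗[ℂ] S) i x,
      j (TensorProduct.equivFinsuppOfBasisRight c t i) x = c.repr (T t x) i := by
    intro t i x
    induction t using TensorProduct.induction_on with
    | zero => simp
    | tmul f u => simp [hT, mul_comm]
    | add t t' h h' => simp [h, h']
  intro t t' h
  apply (TensorProduct.equivFinsuppOfBasisRight c).injective
  ext i
  apply hj
  funext x
  rw [key, key, h]

/-- Elements of `R^ρ(X) ⊗ S` may be identified with the `S`-valued functions they define, so that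
equivariance can be checked pointwise. -/
theorem toFunction_injective {X : Type*} [Group X] [TopologicalSpace X]
    {M : Type*} [AddCommGroup M] [Module ℂ M] (ρ : Representation ℂ X M)
    (S : Type*) [AddCommGroup S] [Module ℂ S] : Function.Injective (toFunction ρ S) :=
  injective_of_tmul_apply (ContinuousMap.coeFnLinearMap ℂ ∘ₗ (coeffSpace ρ).subtype)
    (DFunLike.coe_injective.comp (Submodule.injective_subtype _)) _ (toFunction_tmul ρ)

/-! ### The cyclic trace as a multilinear map -/

section ComposeStep

variable {n : ℕ} {S : Fin (n + 1) → Type*} [∀ i, AddCommGroup (S i)] [∀ i, Module ℂ (S i)]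
  {L M M' : Type*} [AddCommGroup L] [Module ℂ L] [AddCommGroup M] [Module ℂ M]
  [AddCommGroup M'] [Module ℂ M']

theorem composeStep_add_left (A A' : M →ₗ[ℂ] M' ⊗[ℂ] S 0)
    (B : L →ₗ[ℂ] M ⊗[ℂ] (⨂[ℂ] i : Fin n, S i.succ)) :
    composeStep S (A + A') B = composeStep S A B + composeStep S A' B := by
  ext; simp [composeStep, LinearMap.rTensor_add]

theorem composeStep_smul_left (c : ℂ) (A : M →ₗ[ℂ] M' ⊗[ℂ] S 0)
    (B : L →ₗ[ℂ] M ⊗[ℂ] (⨂[ℂ] i : Fin n, S i.succ)) :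
    composeStep S (c • A) B = c • composeStep S A B := by
  ext; simp [composeStep, LinearMap.rTensor_smul]

theorem composeStep_add_right (A : M →ₗ[ℂ] M' ⊗[ℂ] S 0)
    (B B' : L →ₗ[ℂ] M ⊗[ℂ] (⨂[ℂ] i : Fin n, S i.succ)) :
    composeStep S A (B + B') = composeStep S A B + composeStep S A B' := by
  ext; simp [composeStep]

theorem composeStep_smul_right (c : ℂ) (A : M →ₗ[ℂ] M' ⊗[ℂ] S 0)
    (B : L →ₗ[ℂ] M ⊗[ℂ] (⨂[ℂ] i : Fin n, S i.succ)) :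
    composeStep S A (c • B) = c • composeStep S A B := by
  ext; simp [composeStep]

theorem composeStep_smulRight_apply (φ : Module.Dual ℂ M) (m : M') (u : S 0)
    (B : L →ₗ[ℂ] M ⊗[ℂ] (⨂[ℂ] i : Fin n, S i.succ)) (v : L) (c : ℂ) (x : M)
    (w : ∀ i : Fin n, S i.succ) (hB : B v = c • x ⊗ₜ PiTensorProduct.tprod ℂ w) :
    composeStep S (φ.smulRight (m ⊗ₜ u)) B v =
      (φ x * c) • m ⊗ₜ[ℂ] PiTensorProduct.tprod ℂ (Fin.cons u w) := by
  simp [composeStep, hB, TensorProduct.smul_tmul', smul_smul, mul_comm]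

end ComposeStep

theorem composeChain_update_add : ∀ (n : ℕ) (M : Fin (n + 1) → Type*) [∀ i, AddCommGroup (M i)]
    [∀ i, Module ℂ (M i)] (S : Fin n → Type*) [∀ i, AddCommGroup (S i)] [∀ i, Module ℂ (S i)]
    (A : ∀ i : Fin n, M i.succ →ₗ[ℂ] M i.castSucc ⊗[ℂ] S i) (i : Fin n)
    (X Y : M i.succ →ₗ[ℂ] M i.castSucc ⊗[ℂ] S i),
    composeChain n M S (Function.update A i (X + Y)) =
      composeChain n M S (Function.update A i X) + composeChain n M S (Function.update A i Y)
  | 0, _, _, _, _, _, _, _, i, _, _ => i.elim0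
  | n + 1, M, _, _, S, _, _, A, i, X, Y => by
    induction i using Fin.cases with
    | zero => exact composeStep_add_left _ _ _
    | succ i =>
      have h : ∀ Z, composeChain (n + 1) M S (Function.update A i.succ Z) =
          composeStep S (A 0) (composeChain n (fun i => M i.succ) (fun i => S i.succ)
            (Function.update (fun i => A i.succ) i Z)) := fun Z =>
        congrArg (fun T => composeStep S (A 0) (composeChain n (fun i => M i.succ)
          (fun i => S i.succ) T)) (Fin.tail_update_succ A i Z)
      rw [h, h, h, composeChain_update_add, composeStep_add_right]
      rfl

theorem composeChain_update_smul : ∀ (n : ℕ) (M : Fin (n + 1) → Type*) [∀ i, AddCommGroup (M i)]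
    [∀ i, Module ℂ (M i)] (S : Fin n → Type*) [∀ i, AddCommGroup (S i)] [∀ i, Module ℂ (S i)]
    (A : ∀ i : Fin n, M i.succ →ₗ[ℂ] M i.castSucc ⊗[ℂ] S i) (i : Fin n) (c : ℂ)
    (X : M i.succ →ₗ[ℂ] M i.castSucc ⊗[ℂ] S i),
    composeChain n M S (Function.update A i (c • X)) =
      c • composeChain n M S (Function.update A i X)
  | 0, _, _, _, _, _, _, _, i, _, _ => i.elim0
  | n + 1, M, _, _, S, _, _, A, i, c, X => by
    induction i using Fin.cases with
    | zero => exact composeStep_smul_left _ _ _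
    | succ i =>
      have h : ∀ Z, composeChain (n + 1) M S (Function.update A i.succ Z) =
          composeStep S (A 0) (composeChain n (fun i => M i.succ) (fun i => S i.succ)
            (Function.update (fun i => A i.succ) i Z)) := fun Z =>
        congrArg (fun T => composeStep S (A 0) (composeChain n (fun i => M i.succ)
          (fun i => S i.succ) T)) (Fin.tail_update_succ A i Z)
      rw [h, h, composeChain_update_smul, composeStep_smul_right]
      rfl

/-- The composition of the maps of rank one `v ↦ φᵢ(v) xᵢ ⊗ uᵢ`, applied to a vector of `Mₙ`. The
argument is called `xₙ`, which makes the formula uniform in `n`, including `n = 0`. -/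
theorem composeChain_smulRight_apply : ∀ (n : ℕ) (M : Fin (n + 1) → Type*)
    [∀ i, AddCommGroup (M i)] [∀ i, Module ℂ (M i)] (S : Fin n → Type*) [∀ i, AddCommGroup (S i)]
    [∀ i, Module ℂ (S i)] (φ : ∀ i : Fin n, Module.Dual ℂ (M i.succ)) (x : ∀ i, M i)
    (u : ∀ i, S i),
    composeChain n M S (fun i => (φ i).smulRight (x i.castSucc ⊗ₜ u i)) (x (Fin.last n)) =
      (∏ i, φ i (x i.succ)) • x 0 ⊗ₜ[ℂ] PiTensorProduct.tprod ℂ u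
  | 0, M, _, _, S, _, _, φ, x, u => by
    have h : (fun i : Fin 0 => i.elim0) = u := funext fun i => i.elim0
    simp [composeChain, ← h]
  | n + 1, M, _, _, S, _, _, φ, x, u => by
    have ih := composeChain_smulRight_apply n (fun i => M i.succ) (fun i => S i.succ)
      (fun i => φ i.succ) (fun i => x i.succ) (fun i => u i.succ)
    refine (composeStep_smulRight_apply (φ 0) (x 0) (u 0) _ _ _ _ _ ih).trans ?_
    rw [Fin.prod_univ_succ]
    congr 3
    exact Fin.cons_self_tail u

section PartialTrace

variable {M S : Type*} [AddCommGroup M] [Module ℂ M] [AddCommGroup S] [Module ℂ S]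
  [FiniteDimensional ℂ S]

theorem partialTrace_add (B B' : M →ₗ[ℂ] M ⊗[ℂ] S) :
    partialTrace (B + B') = partialTrace B + partialTrace B' := by
  refine (Module.evalEquiv ℂ S).injective (LinearMap.ext fun φ => ?_)
  simp only [Module.evalEquiv_apply, Module.Dual.eval_apply]
  simp only [map_add, apply_partialTrace, LinearMap.comp_add]

theorem partialTrace_smul (c : ℂ) (B : M →ₗ[ℂ] M ⊗[ℂ] S) :
    partialTrace (c • B) = c • partialTrace B := by
  refine (Module.evalEquiv ℂ S).injective (LinearMap.ext fun φ => ?_)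
  simp only [Module.evalEquiv_apply, Module.Dual.eval_apply]
  simp only [map_smul, apply_partialTrace, LinearMap.comp_smul]

/-- The partial trace as a linear map. -/
def partialTraceLinear : (M →ₗ[ℂ] M ⊗[ℂ] S) →ₗ[ℂ] S where
  toFun := partialTrace
  map_add' := partialTrace_add
  map_smul' := partialTrace_smul

theorem partialTrace_smulRight [FiniteDimensional ℂ M] (φ : Module.Dual ℂ M) (m : M) (u : S) :
    partialTrace (φ.smulRight (m ⊗ₜ[ℂ] u)) = φ m • u := by
  refine (Module.evalEquiv ℂ S).injective (LinearMap.ext fun ψ => ?_)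
  simp only [Module.evalEquiv_apply, Module.Dual.eval_apply]
  have h : (TensorProduct.rid ℂ M).toLinearMap ∘ₗ LinearMap.lTensor M ψ ∘ₗ
      φ.smulRight (m ⊗ₜ[ℂ] u) = φ.smulRight (ψ u • m) := by
    ext v
    simp
  rw [apply_partialTrace, h, LinearMap.trace_smulRight]
  simp [mul_comm]

end PartialTrace

section CyclicTrace

variable {n : ℕ} {M S : Fin (n + 1) → Type*}
  [∀ i, AddCommGroup (M i)] [∀ i, Module ℂ (M i)]
  [∀ i, AddCommGroup (S i)] [∀ i, Module ℂ (S i)]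

/-- The composition `(A₀ ⊗ id) (A₁ ⊗ id) ⋯ Aₙ : Mₙ → Mₙ ⊗ (S₀ ⊗ ⋯ ⊗ Sₙ)` of arbitrary linear maps
`Aᵢ : Mᵢ → Mᵢ₋₁ ⊗ Sᵢ`, as a multilinear map in `(A₀, …, Aₙ)`. -/
def cyclicCompose : MultilinearMap ℂ (fun i => M i →ₗ[ℂ] M (cyclicPred i) ⊗[ℂ] S i)
    (M (Fin.last n) →ₗ[ℂ] M (Fin.last n) ⊗[ℂ] (⨂[ℂ] i, S i)) :=
  MultilinearMap.mk' (fun A => composeStep S (M := M 0) (M' := M (Fin.last n)) (A 0)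
      (composeChain n M (fun i => S i.succ) (fun i => A i.succ)))
    (fun A i X Y => by
      induction i using Fin.cases with
      | zero => exact composeStep_add_left _ _ _
      | succ i =>
        have h : ∀ Z, composeStep S (M := M 0) (M' := M (Fin.last n))
            (Function.update A i.succ Z 0) (composeChain n M (fun i => S i.succ)
              (fun j => Function.update A i.succ Z j.succ)) =
            composeStep S (M := M 0) (M' := M (Fin.last n)) (A 0)
              (composeChain n M (fun i => S i.succ)
                (Function.update (fun j => A j.succ) i Z)) := fun Z =>
          congrArg (fun T => composeStep S (M := M 0) (M' := M (Fin.last n)) (A 0)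
            (composeChain n M (fun i => S i.succ) T)) (Fin.tail_update_succ A i Z)
        exact (h _).trans <| (congrArg (composeStep S (M := M 0) (M' := M (Fin.last n)) (A 0))
          (composeChain_update_add _ _ _ _ _ _ _)).trans <|
            (composeStep_add_right _ _ _).trans (congrArg₂ (· + ·) (h _).symm (h _).symm))
    (fun A i c X => by
      induction i using Fin.cases with
      | zero => exact composeStep_smul_left _ _ _
      | succ i =>
        have h : ∀ Z, composeStep S (M := M 0) (M' := M (Fin.last n))
            (Function.update A i.succ Z 0) (composeChain n M (fun i => S i.succ)
              (fun j => Function.update A i.succ Z j.succ)) =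
            composeStep S (M := M 0) (M' := M (Fin.last n)) (A 0)
              (composeChain n M (fun i => S i.succ)
                (Function.update (fun j => A j.succ) i Z)) := fun Z =>
          congrArg (fun T => composeStep S (M := M 0) (M' := M (Fin.last n)) (A 0)
            (composeChain n M (fun i => S i.succ) T)) (Fin.tail_update_succ A i Z)
        exact (h _).trans <| (congrArg (composeStep S (M := M 0) (M' := M (Fin.last n)) (A 0))
          (composeChain_update_smul _ _ _ _ _ _ _)).trans <|
            (composeStep_smul_right _ _ _).trans (congrArg (c • ·) (h _).symm))

variable [∀ i, FiniteDimensional ℂ (S i)]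

/-- The partial trace of the cyclic composition, as a multilinear map. -/
def cyclicTrace : MultilinearMap ℂ (fun i => M i →ₗ[ℂ] M (cyclicPred i) ⊗[ℂ] S i)
    (⨂[ℂ] i, S i) :=
  partialTraceLinear.compMultilinearMap cyclicCompose

/-- The cyclic trace of the maps of rank one `v ↦ φᵢ(v) yᵢ₋₁ ⊗ uᵢ` is the product of the numbers
`φᵢ(yᵢ)`, times the tensor `⨂ᵢ uᵢ`. -/
theorem cyclicTrace_smulRight [∀ i, FiniteDimensional ℂ (M i)] (φ : ∀ i, Module.Dual ℂ (M i))
    (y : ∀ i, M i) (u : ∀ i, S i) :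
    cyclicTrace (fun i => (φ i).smulRight (y (cyclicPred i) ⊗ₜ[ℂ] u i)) =
      (∏ i, φ i (y i)) • PiTensorProduct.tprod ℂ u := by
  have h : cyclicCompose (fun i => (φ i).smulRight (y (cyclicPred i) ⊗ₜ[ℂ] u i)) =
      ((∏ i : Fin n, φ i.castSucc (y i.castSucc)) • φ (Fin.last n)).smulRight
        (y (Fin.last n) ⊗ₜ[ℂ] PiTensorProduct.tprod ℂ u) := by
    ext v
    -- the first step of the composition acts on the result of the chain; in the formula for the
    -- chain the vector at the last place is the argument `v` instead of `yₙ`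
    let x : ∀ i, M i := Fin.snoc (fun i : Fin n => y i.castSucc) v
    have hx : ∀ i : Fin n, x i.castSucc = y i.castSucc := fun i => Fin.snoc_castSucc _ _ _
    have hv : x (Fin.last n) = v := Fin.snoc_last _ _
    have hc := composeChain_smulRight_apply n M (fun i => S i.succ) (fun i => φ i.succ) x
      (fun i => u i.succ)
    simp only [hx, hv] at hc
    refine (composeStep_smulRight_apply (S := S) (φ 0) (y (Fin.last n)) (u 0) _ v _ _ _ hc).trans ?_
    have hu : (Fin.cons (u 0) fun i : Fin n => u i.succ : ∀ i, S i) = u := Fin.cons_self_tail u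
    rw [hu, ← Fin.prod_univ_succ (fun i => φ i (x i)), Fin.prod_univ_castSucc]
    simp only [hx, hv]
    rfl
  change partialTrace (cyclicCompose _) = _
  rw [h, partialTrace_smulRight, Fin.prod_univ_castSucc]
  rfl

end CyclicTrace

/-! ### Trace functions and spin graph functions -/

section Main

variable {G : Type*} [Group G] {n : ℕ} {M S : Fin (n + 1) → Type*}
  [∀ i, AddCommGroup (M i)] [∀ i, Module ℂ (M i)]
  [∀ i, AddCommGroup (S i)] [∀ i, Module ℂ (S i)]
  (π : ∀ i, Representation ℂ G (M i)) (σ : ∀ i, Representation ℂ G (S i))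

/-- The space `Hom(Mᵢ, Mᵢ₋₁ ⊗ Sᵢ)` of all linear maps at the vertex `i`. -/
abbrev LocalHom (M S : Fin (n + 1) → Type*) [∀ i, AddCommGroup (M i)] [∀ i, Module ℂ (M i)]
    [∀ i, AddCommGroup (S i)] [∀ i, Module ℂ (S i)] (i : Fin (n + 1)) : Type _ :=
  M i →ₗ[ℂ] M (cyclicPred i) ⊗[ℂ] S i

/-- The action of the gauge transformations at the vertex `i` on `Hom(Mᵢ, Mᵢ₋₁ ⊗ Sᵢ)`. Its
invariants are the local intertwiners. -/
def localHomRep (i : Fin (n + 1)) : Representation ℂ G (LocalHom M S i) :=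
  Representation.linHom (π i) ((π (cyclicPred i)).tprod (σ i))

/-- The tensor of the maps of rank one `v ↦ φᵢ(v) yᵢ₋₁ ⊗ uᵢ`. -/
def rankOneTensor (φ : ∀ i, Module.Dual ℂ (M i)) (y : ∀ i, M i) (u : ∀ i, S i) :
    ⨂[ℂ] i, LocalHom M S i :=
  PiTensorProduct.tprod ℂ fun i => (φ i).smulRight (y (cyclicPred i) ⊗ₜ[ℂ] u i)

/-- A gauge transformation maps a tensor of maps of rank one to another one. Since `yᵢ` belongs to
the vertex `i + 1`, it is transformed by `kᵢ₊₁`. -/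
theorem tensorRep_rankOneTensor (φ : ∀ i, Module.Dual ℂ (M i)) (y : ∀ i, M i) (u : ∀ i, S i)
    (k : Fin (n + 1) → G) : tensorRep (localHomRep π σ) k (rankOneTensor φ y u) =
      rankOneTensor (fun i => φ i ∘ₗ π i (k i)⁻¹) (fun i => π i (k (i + 1)) (y i))
        (fun i => σ i (k i) (u i)) := by
  change PiTensorProduct.map _ (PiTensorProduct.tprod ℂ _) = PiTensorProduct.tprod ℂ _
  rw [PiTensorProduct.map_tprod]
  congr 1
  funext i
  have hi : cyclicPred i + 1 = i := by rw [cyclicPred_eq, sub_add_cancel]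
  refine LinearMap.ext fun v => ?_
  simp [localHomRep, hi]

/-- The index of an element of the basis `basisLocal` below: by cyclic shift, a family of indices
for the spaces `Mᵢ₋₁` is the same as a family of indices for the spaces `Mᵢ`. The `cast` is along
`(i + 1) - 1 = i`, which is not a definitional equality. -/
def indexEquiv (J K : Fin (n + 1) → Type*) :
    (∀ i, (J (cyclicPred i) × K i) × J i) ≃ ((∀ i, J i) × (∀ i, J i)) × (∀ i, K i) where
  toFun a := ((fun i => (a i).2, fun i =>
    cast (congrArg J (show cyclicPred (i + 1) = i by rw [cyclicPred_eq, add_sub_cancel_right]))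
      (a (i + 1)).1.1), fun i => (a i).1.2)
  invFun a i := ((a.1.2 (cyclicPred i), a.2 i), a.1.1 i)
  left_inv a := by
    have h : ∀ i j (h : j = i) (e : J (cyclicPred j) = J (cyclicPred i)),
        cast e (a j).1.1 = (a i).1.1 := by
      rintro i _ rfl _; rfl
    funext i
    refine Prod.ext (Prod.ext (h i _ ?_ _) rfl) rfl
    rw [cyclicPred_eq, sub_add_cancel]
  right_inv a := by
    have h : ∀ i j (h : j = i) (e : J j = J i), cast e (a.1.2 j) = a.1.2 i := by
      rintro i _ rfl _; rfl
    refine Prod.ext (Prod.ext rfl (funext fun i => h i _ ?_ _)) rfl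
    rw [cyclicPred_eq, add_sub_cancel_right]

variable {J K : Fin (n + 1) → Type*} [∀ i, Fintype (J i)] [∀ i, Fintype (K i)]
  (b : ∀ i, Module.Basis (J i) ℂ (M i)) (c : ∀ i, Module.Basis (K i) ℂ (S i))

open Classical in
/-- The basis of `⨂ᵢ Hom(Mᵢ, Mᵢ₋₁ ⊗ Sᵢ)` given by the tensors of maps of rank one built from
elements of bases. -/
def basisLocal : Module.Basis (((∀ i, J i) × (∀ i, J i)) × (∀ i, K i)) ℂ
    (⨂[ℂ] i, LocalHom M S i) :=
  (Basis.piTensorProduct fun i =>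
    (b i).linearMap ((b (cyclicPred i)).tensorProduct (c i))).reindex (indexEquiv J K)

theorem basisLocal_apply (a : ((∀ i, J i) × (∀ i, J i)) × (∀ i, K i)) :
    basisLocal b c a = rankOneTensor (fun i => (b i).coord (a.1.1 i)) (fun i => b i (a.1.2 i))
      (fun i => c i (a.2 i)) := by
  classical
  rw [basisLocal, Module.Basis.reindex_apply, Basis.piTensorProduct_apply, rankOneTensor]
  congr 1
  funext i
  refine (b i).ext fun j => ?_
  rw [Module.Basis.linearMap_apply_apply]
  simp [indexEquiv, Finsupp.single_apply, eq_comm]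

theorem toFunction_spinRep [TopologicalSpace G] [IsTopologicalGroup G] (k g : Fin (n + 1) → G)
    (t : ↥(coeffSpace (tensorRep π)) ⊗[ℂ] (⨂[ℂ] i, S i)) :
    toFunction (tensorRep π) (⨂[ℂ] i, S i)
        (spinRep (cycleGraph n) (tensorRep π) (tensorRep σ) k t) g =
      tensorRep σ k (toFunction (tensorRep π) (⨂[ℂ] i, S i) t
        (gaugeAct (cycleGraph n) k⁻¹ g)) := by
  induction t using TensorProduct.induction_on with
  | zero => simp
  | tmul f u =>
    rw [toFunction_tmul, map_smul]
    rfl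
  | add t t' h h' => simp only [map_add, Pi.add_apply, h, h']

variable [∀ i, FiniteDimensional ℂ (S i)]

/-- The trace function of a tensor of linear maps `Mᵢ → Mᵢ₋₁ ⊗ Sᵢ` which need not be
intertwiners. -/
def traceMap : (⨂[ℂ] i, LocalHom M S i) →ₗ[ℂ] ((Fin (n + 1) → G) → ⨂[ℂ] i, S i) :=
  LinearMap.pi fun g => PiTensorProduct.lift <| cyclicTrace.compLinearMap fun i =>
    LinearMap.lcomp ℂ (M (cyclicPred i) ⊗[ℂ] S i) (π i (g i))

theorem traceMap_tprod_intertwiner (Φ : ∀ i, LocalIntertwiner π σ i) :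
    traceMap π (PiTensorProduct.tprod ℂ fun i => (Φ i).toLinearMap) = traceFunction Φ := by
  funext g
  simp only [traceMap, LinearMap.pi_apply, PiTensorProduct.lift.tprod]
  rfl

variable [∀ i, FiniteDimensional ℂ (M i)]

theorem traceMap_rankOneTensor (φ : ∀ i, Module.Dual ℂ (M i)) (y : ∀ i, M i) (u : ∀ i, S i)
    (g : Fin (n + 1) → G) : traceMap π (rankOneTensor φ y u) g =
      (∏ i, φ i (π i (g i) (y i))) • PiTensorProduct.tprod ℂ u := by
  simp only [traceMap, rankOneTensor, LinearMap.pi_apply, PiTensorProduct.lift.tprod,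
    MultilinearMap.compLinearMap_apply]
  exact cyclicTrace_smulRight (fun i => φ i ∘ₗ π i (g i)) y u

/-- The gauge equivariance of the trace. As the maps of rank one span, it is enough to check it on
these, where it is visible from the formula `traceMap_rankOneTensor`. -/
theorem traceMap_tensorRep (k g : Fin (n + 1) → G) (x : ⨂[ℂ] i, LocalHom M S i) :
    traceMap π (tensorRep (localHomRep π σ) k x) g =
      tensorRep σ k (traceMap π x (gaugeAct (cycleGraph n) k⁻¹ g)) := by
  have h : LinearMap.proj g ∘ₗ traceMap π ∘ₗ tensorRep (localHomRep π σ) k =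
      tensorRep σ k ∘ₗ LinearMap.proj (gaugeAct (cycleGraph n) k⁻¹ g) ∘ₗ
        traceMap (S := S) π := by
    refine (basisLocal (fun i => Module.finBasis ℂ (M i))
      (fun i => Module.finBasis ℂ (S i))).ext fun a => ?_
    simp only [LinearMap.comp_apply, LinearMap.proj_apply, basisLocal_apply,
      tensorRep_rankOneTensor, traceMap_rankOneTensor, map_smul]
    congr 1
    · refine Finset.prod_congr rfl fun i _ => ?_
      simp [gaugeAct, cycleGraph]
    · exact (PiTensorProduct.map_tprod _ _).symm
  exact LinearMap.congr_fun h x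

/-- Without invariance, `⨂ᵢ Aᵢ ↦ f_A` is an isomorphism from `⨂ᵢ Hom(Mᵢ, Mᵢ₋₁ ⊗ Sᵢ)` to
`R^π ⊗ S`: it maps a basis to a basis. -/
theorem exists_traceEquiv [TopologicalSpace G] (hcont : ∀ i, IsContinuousRep (π i))
    (hirr : ∀ i, (π i).IsIrreducible) :
    ∃ Ψ : (⨂[ℂ] i, LocalHom M S i) ≃ₗ[ℂ] (↥(coeffSpace (tensorRep π)) ⊗[ℂ] (⨂[ℂ] i, S i)),
      ∀ x, toFunction (tensorRep π) (⨂[ℂ] i, S i) (Ψ x) = traceMap π x := by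
  let b := fun i => Module.finBasis ℂ (M i)
  let c := fun i => Module.finBasis ℂ (S i)
  let BR := (coeffBasis hcont b hirr).tensorProduct (Basis.piTensorProduct c)
  refine ⟨(basisLocal b c).equiv BR (Equiv.refl _), fun x => ?_⟩
  rw [← LinearEquiv.coe_toLinearMap, ← LinearMap.comp_apply]
  congr 1
  refine (basisLocal b c).ext fun a => ?_
  funext g
  rw [LinearMap.comp_apply, LinearEquiv.coe_toLinearMap, Module.Basis.equiv_apply]
  rw [basisLocal_apply, traceMap_rankOneTensor, Module.Basis.tensorProduct_apply,
    toFunction_tmul, Equiv.refl_apply, coeffBasis_apply, productCoeff_apply,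
    Basis.piTensorProduct_apply]

/-- The isomorphism of `exists_traceEquiv` is equivariant for the gauge group, and on invariants it
is the isomorphism from tensors of intertwiners to elementary spin graph functions. -/
theorem exists_intertwinerEquiv [TopologicalSpace G] [IsTopologicalGroup G]
    (hcont : ∀ i, IsContinuousRep (π i)) (hirr : ∀ i, (π i).IsIrreducible) :
    ∃ e : (⨂[ℂ] i, LocalIntertwiner π σ i) ≃ₗ[ℂ]
        ↥(elementarySpinGraphFunctions (cycleGraph n) (tensorRep π) (tensorRep σ)),
      ∀ Φ : (∀ i, LocalIntertwiner π σ i),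
        toFunction (tensorRep π) (⨂[ℂ] i, S i) (e (PiTensorProduct.tprod ℂ Φ)).1 =
          traceFunction Φ := by
  obtain ⟨Ψ, hΨ⟩ := exists_traceEquiv (S := S) π hcont hirr
  have hequiv : ∀ k x, Ψ (tensorRep (localHomRep π σ) k x) =
      spinRep (cycleGraph n) (tensorRep π) (tensorRep σ) k (Ψ x) := by
    intro k x
    apply toFunction_injective
    funext g
    rw [hΨ, traceMap_tensorRep, toFunction_spinRep, hΨ]
  let I := Representation.invariants (V := ⨂[ℂ] i, LocalHom M S i)
    (tensorRep (localHomRep π σ))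
  have hinv : I.map Ψ.toLinearMap =
      elementarySpinGraphFunctions (cycleGraph n) (tensorRep π) (tensorRep σ) := by
    ext t
    constructor
    · rintro ⟨x, hx, rfl⟩ k
      exact (hequiv k x).symm.trans (congrArg Ψ (hx k))
    · intro ht
      refine ⟨Ψ.symm t, fun k => Ψ.injective ?_, Ψ.apply_symm_apply t⟩
      rw [hequiv, Ψ.apply_symm_apply]
      exact ht k
  obtain ⟨e₁, he₁⟩ := exists_tensor_invariants_equiv (localHomRep π σ) fun i =>
    (Representation.invariantsEquivIntertwiningMap (π i)
      ((π (cyclicPred i)).tprod (σ i))).symm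
  refine ⟨e₁ ≪≫ₗ Ψ.submoduleMap _ ≪≫ₗ LinearEquiv.ofEq _ _ hinv, fun Φ => ?_⟩
  rw [← traceMap_tprod_intertwiner, ← hΨ]
  exact congrArg (fun x => toFunction (tensorRep π) (⨂[ℂ] i, S i) (Ψ x)) (he₁ Φ)

end Main

end SpinGraph

end

theorem mainTheorem4
    -- a connected compact (real, finite dimensional) Lie group `G`
    {E : Type*} [NormedAddCommGroup E] [NormedSpace ℝ E] [FiniteDimensional ℝ E]
    {G : Type*} [Group G] [TopologicalSpace G] [ChartedSpace E G] [LieGroup 𝓘(ℝ, E) ∞ G]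
    [IsTopologicalGroup G] [T2Space G] [CompactSpace G] [ConnectedSpace G]
    -- the cycle graph has `n + 1` edges
    (n : ℕ)
    {M S : Fin (n + 1) → Type*}
    [∀ i, AddCommGroup (M i)] [∀ i, Module ℂ (M i)] [∀ i, FiniteDimensional ℂ (M i)]
    [∀ i, AddCommGroup (S i)] [∀ i, Module ℂ (S i)] [∀ i, FiniteDimensional ℂ (S i)]
    (π : ∀ i, Representation ℂ G (M i)) (σ : ∀ i, Representation ℂ G (S i))
    (hcont : ∀ i, SpinGraph.IsContinuousRep (π i)) (hirr : ∀ i, (π i).IsIrreducible) :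
    -- `⨂ Φᵢ ↦ f_Φ` is a linear isomorphism onto the elementary spin graph functions
    (∃ e : (⨂[ℂ] i, SpinGraph.LocalIntertwiner π σ i) ≃ₗ[ℂ]
        ↥(SpinGraph.elementarySpinGraphFunctions (SpinGraph.cycleGraph n)
          (SpinGraph.tensorRep π) (SpinGraph.tensorRep σ)),
      ∀ Φ : (∀ i, SpinGraph.LocalIntertwiner π σ i),
        SpinGraph.toFunction (SpinGraph.tensorRep π) (⨂[ℂ] i, S i)
          (e (PiTensorProduct.tprod ℂ Φ)).1 = SpinGraph.traceFunction Φ) ∧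
    -- the elementary spin graph functions are the linear combinations of trace functions
    Submodule.map (SpinGraph.toFunction (SpinGraph.tensorRep π) (⨂[ℂ] i, S i))
        (SpinGraph.elementarySpinGraphFunctions (SpinGraph.cycleGraph n)
          (SpinGraph.tensorRep π) (SpinGraph.tensorRep σ)) =
      Submodule.span ℂ (Set.range fun Φ : (∀ i, SpinGraph.LocalIntertwiner π σ i) =>
        SpinGraph.traceFunction Φ) := by
  obtain ⟨e, he⟩ := SpinGraph.exists_intertwinerEquiv π σ hcont hirr
  refine ⟨⟨e, he⟩, ?_⟩
  have hmap : Submodule.map (SpinGraph.toFunction (SpinGraph.tensorRep π) (⨂[ℂ] i, S i))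
      (SpinGraph.elementarySpinGraphFunctions (SpinGraph.cycleGraph n)
        (SpinGraph.tensorRep π) (SpinGraph.tensorRep σ)) =
      LinearMap.range (SpinGraph.toFunction (SpinGraph.tensorRep π) (⨂[ℂ] i, S i) ∘ₗ
        Submodule.subtype _ ∘ₗ e.toLinearMap) := by
    rw [LinearMap.range_comp, LinearMap.range_comp_of_range_eq_top _ e.range,
      Submodule.range_subtype]
  rw [hmap, LinearMap.range_eq_map, ← PiTensorProduct.span_tprod_eq_top, Submodule.map_span,
    ← Set.range_comp]
  exact congrArg (fun f => Submodule.span ℂ (Set.range f)) (funext he)
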